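/- Let $(M,g)$ be a nonempty smooth Riemannian manifold of dimension $n\ge 1$ with Levi-Civita connection $\nabla$ and scalar curvature $R$. Let $v$ be a smooth vector field on $M$ and $\rho\in\mathbb{R}$ a constant such that $(M,g,v,\rho)$ is a Yamabe soliton, i.e. $$(R-\rho)\,g=\tfrac12\,\mathcal{L}_v g ,$$ and suppose that $v$ is concurrent, i.e. $\nabla_X v=X$ for every vector $X$ tangent to $M$. Then $(M,g,v,\rho)$ is a gradient expanding Yamabe soliton with zero scalar curvature and $\rho=-1$: there is a smooth function $f:M\to\mathbb{R}$ with $v=\nabla f$, the constant $\rho$ is negative, $R\equiv 0$ on $M$, and $\rho=-1$. -/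

import Mathlib

open Bundle Manifold VectorField
open scoped ContDiff

noncomputable section

namespace YamabeSoliton

section Defs

set_option linter.unusedSectionVars false

-- `M` is a smooth manifold with finite-dimensional model `E`, carrying a smooth Riemannian metric,
-- which is written `inner ℝ` on each tangent space.
variable {E : Type*} [NormedAddCommGroup E] [NormedSpace ℝ E] [FiniteDimensional ℝ E]
  {H : Type*} [TopologicalSpace H] {I : ModelWithCorners ℝ E H}
  {M : Type*} [TopologicalSpace M] [ChartedSpace H M] [IsManifold I ∞ M]
  [RiemannianBundle (fun x : M ↦ TangentSpace I x)]
  [IsContMDiffRiemannianBundle I ∞ E (fun x : M ↦ TangentSpace I x)]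

/-- The right-hand side of the Koszul formula for `2 ⟨∇_X Y, Z⟩` at `x`. -/
def koszul (Y X Z : Π x : M, TangentSpace I x) (x : M) : ℝ :=
  mvfderiv I (fun y ↦ inner ℝ (Y y) (Z y)) x (X x)
    + mvfderiv I (fun y ↦ inner ℝ (X y) (Z y)) x (Y x)
    - mvfderiv I (fun y ↦ inner ℝ (X y) (Y y)) x (Z x)
    + inner ℝ (mlieBracket I X Y x) (Z x)
    - inner ℝ (mlieBracket I X Z x) (Y x)
    - inner ℝ (mlieBracket I Y Z x) (X x)

theorem mdiff_inner {Y Z : Π x : M, TangentSpace I x} {x : M}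
    (hY : MDiffAt (T% Y) x) (hZ : MDiffAt (T% Z) x) :
    MDiffAt (fun y ↦ inner ℝ (Y y) (Z y)) x :=
  MDifferentiableAt.inner_bundle (E := fun x : M ↦ TangentSpace I x) hY hZ

theorem finDim_tangentSpace (x : M) : FiniteDimensional ℝ (TangentSpace I x) := inferInstanceAs (FiniteDimensional ℝ E)


theorem complete_tangentSpace (x : M) : CompleteSpace (TangentSpace I x) :=
  have := finDim_tangentSpace (I := I) x
  FiniteDimensional.complete ℝ _


theorem koszul_tensorial_left {Y Z : Π x : M, TangentSpace I x} {x : M}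
    (hY : MDiffAt (T% Y) x) (hZ : MDiffAt (T% Z) x) :
    TensorialAt I E (fun X ↦ koszul Y X Z x) x where
  smul {f X} hf hX := by
    simp [koszul, mlieBracket_smul_left hf hX, mvfderiv_fun_mul hf (mdiff_inner hX hZ),
     mvfderiv_fun_mul hf (mdiff_inner hX hY), inner_smul_left, inner_smul_right, inner_add_left]
    ring
  add {X X'} hX hX' := by
    simp [koszul, mlieBracket_add_left hX hX',
     mvfderiv_fun_add (mdiff_inner hX hZ) (mdiff_inner hX' hZ),
     mvfderiv_fun_add (mdiff_inner hX hY) (mdiff_inner hX' hY), inner_add_left, inner_add_right]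
    ring

theorem koszul_tensorial_right {Y X : Π x : M, TangentSpace I x} {x : M}
    (hY : MDiffAt (T% Y) x) (hX : MDiffAt (T% X) x) :
    TensorialAt I E (fun Z ↦ koszul Y X Z x) x where
  smul {f Z} hf hZ := by
    simp [koszul, mlieBracket_smul_right hf hZ, mvfderiv_fun_mul hf (mdiff_inner hX hZ),
     mvfderiv_fun_mul hf (mdiff_inner hY hZ), inner_smul_left, inner_smul_right, inner_add_left]
    rw [real_inner_comm (X x) (Z x), real_inner_comm (Y x) (Z x)]
    ring
  add {Z Z'} hZ hZ' := by
    simp [koszul, mlieBracket_add_right hZ hZ',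
     mvfderiv_fun_add (mdiff_inner hX hZ) (mdiff_inner hX hZ'),
     mvfderiv_fun_add (mdiff_inner hY hZ) (mdiff_inner hY hZ'), inner_add_left, inner_add_right]
    ring

theorem koszul_add {Y Y' X Z : Π x : M, TangentSpace I x} {x : M}
    (hY : MDiffAt (T% Y) x) (hY' : MDiffAt (T% Y') x)
    (hX : MDiffAt (T% X) x) (hZ : MDiffAt (T% Z) x) :
    koszul (Y + Y') X Z x = koszul Y X Z x + koszul Y' X Z x := by
  simp [koszul, mlieBracket_add_right hY hY', mlieBracket_add_left hY hY',
     mvfderiv_fun_add (mdiff_inner hY hZ) (mdiff_inner hY' hZ),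
     mvfderiv_fun_add (mdiff_inner hX hY) (mdiff_inner hX hY'), inner_add_left, inner_add_right]
  ring

theorem koszul_smul {Y X Z : Π x : M, TangentSpace I x} {f : M → ℝ} {x : M}
    (hf : MDiffAt f x) (hY : MDiffAt (T% Y) x)
    (hX : MDiffAt (T% X) x) (hZ : MDiffAt (T% Z) x) :
    koszul (f • Y) X Z x
      = f x * koszul Y X Z x + 2 * (mvfderiv I f x (X x) * inner ℝ (Y x) (Z x)) := by
  simp [koszul, mlieBracket_smul_right hf hY, mlieBracket_smul_left hf hY,
     mvfderiv_fun_mul hf (mdiff_inner hY hZ),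
     mvfderiv_fun_mul hf (mdiff_inner hX hY), inner_add_left, inner_smul_left, inner_smul_right]
  rw [real_inner_comm (X x) (Y x)]
  ring

theorem exists_leviCivita_at (Y : Π x : M, TangentSpace I x) (x : M) :
    ∃ A : TangentSpace I x →L[ℝ] TangentSpace I x, MDiffAt (T% Y) x →
      ∀ X Z : Π x : M, TangentSpace I x, MDiffAt (T% X) x → MDiffAt (T% Z) x →
        2 * inner ℝ (A (X x)) (Z x) = koszul Y X Z x := by
  by_cases hY : MDiffAt (T% Y) x
  swap
  · exact ⟨0, fun h ↦ (hY h).elim⟩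
  have := finDim_tangentSpace (I := I) x
  have := complete_tangentSpace (I := I) x
  let B : TangentSpace I x →L[ℝ] TangentSpace I x →L[ℝ] ℝ :=
    TensorialAt.mkHom₂ (I := I) (F := E) (F' := E) (fun X Z ↦ koszul Y X Z x) x
      (fun Z hZ ↦ koszul_tensorial_left hY hZ) (fun X hX ↦ koszul_tensorial_right hY hX)
  let A : TangentSpace I x →ₗ[ℝ] TangentSpace I x :=
    { toFun := fun X ↦ (1 / 2 : ℝ) • (InnerProductSpace.toDual ℝ (TangentSpace I x)).symm (B X)
      map_add' := by intro a b; simp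
      map_smul' := by
        intro a b
        simp [smul_comm a] }
  refine ⟨LinearMap.toContinuousLinearMap A, fun _ X Z hX hZ ↦ ?_⟩
  have h : B (X x) (Z x) = koszul Y X Z x := TensorialAt.mkHom₂_apply _ _ hX hZ
  have h2 : inner ℝ ((InnerProductSpace.toDual ℝ (TangentSpace I x)).symm (B (X x))) (Z x)
    = B (X x) (Z x) := InnerProductSpace.toDual_symm_apply
  change 2 * inner ℝ ((1 / 2 : ℝ) • (InnerProductSpace.toDual ℝ (TangentSpace I x)).symm (B (X x))) (Z x) = _
  rw [real_inner_smul_left, h2, h]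
  ring

theorem ext_extend {x : M} {u w : TangentSpace I x}
    (h : ∀ Z : Π x : M, TangentSpace I x, MDiffAt (T% Z) x → inner ℝ u (Z x) = inner ℝ w (Z x)) :
    u = w := by
  refine ext_inner_right ℝ fun z ↦ ?_
  simpa using h (FiberBundle.extend E z) (FiberBundle.mdifferentiableAt_extend ..)

variable (I M) in
/-- Every Riemannian manifold carries a torsion-free metric connection. -/
theorem exists_leviCivita :
    ∃ cov : CovariantDerivative I E (fun x : M ↦ TangentSpace I x),
      cov.torsion = 0 ∧
        CovariantDerivative.IsMetricCompatible (V := fun x : M ↦ TangentSpace I x) cov := by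
  choose A hA using exists_leviCivita_at (I := I) (M := M)
  have hext : ∀ {x : M} (X : TangentSpace I x), MDiffAt (T% (FiberBundle.extend E X)) x :=
    fun X ↦ FiberBundle.mdifferentiableAt_extend ..
  let cov : CovariantDerivative I E (fun x : M ↦ TangentSpace I x) :=
    ⟨A, ⟨by
      intro Y Y' x hY hY' _
      ext X
      refine ext_extend fun Z hZ ↦ ?_
      have h1 := hA _ x (mdifferentiableAt_add_section hY hY') _ Z (hext X) hZ
      have h2 := hA _ x hY _ Z (hext X) hZ
      have h3 := hA _ x hY' _ Z (hext X) hZ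
      have h4 := koszul_add hY hY' (hext X) hZ
      simp [inner_add_left] at *
      linarith, by
      intro Y f x hY hf _
      ext X
      refine ext_extend fun Z hZ ↦ ?_
      have h1 := hA _ x (hf.smul_section hY) _ Z (hext X) hZ
      have h2 := hA _ x hY _ Z (hext X) hZ
      have h4 := koszul_smul hf hY (hext X) hZ
      simp [inner_add_left, inner_smul_left] at *
      linear_combination (h1 - f x * h2 + h4) / 2⟩⟩
  refine ⟨cov, ?_, ?_⟩
  · rw [CovariantDerivative.torsion_eq_zero_iff]
    intro X Y x hX hY
    refine ext_extend fun Z hZ ↦ ?_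
    have h1 := hA _ x hY _ Z hX hZ
    have h2 := hA _ x hX _ Z hY hZ
    change inner ℝ (A Y x (X x) - A X x (Y x)) _ = _
    simp [koszul, inner_sub_left] at *
    rw [mlieBracket_swap_apply (V := Y) (W := X)] at h2
    simp only [inner_neg_left, real_inner_comm (Y _) (X _)] at h1 h2 ⊢
    linarith
  · rw [CovariantDerivative.isMetricCompatible_iff]
    intro x X Y Z hX hY hZ
    have h1 := hA _ x hY _ Z hX hZ
    have h2 := hA _ x hZ _ Y hX hY
    change _ = inner ℝ (A Y x (X x)) (Z x) + inner ℝ (Y x) (A Z x (X x))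
    rw [real_inner_comm (A Z x (X x))]
    simp only [koszul] at *
    rw [mlieBracket_swap_apply (V := Z) (W := Y)] at h2
    simp only [inner_neg_left, real_inner_comm (Y _) (Z _)] at h1 h2 ⊢
    linarith

variable (I M) in
/-- The Levi-Civita connection: the torsion-free connection on the tangent bundle that is
compatible with the metric. Its value `leviCivita I M Y x X` is `∇_X Y` at `x`. -/
def leviCivita : CovariantDerivative I E (fun x : M ↦ TangentSpace I x) :=
  (exists_leviCivita I M).choose

theorem leviCivita_torsion : (leviCivita I M).torsion = 0 :=
  (exists_leviCivita I M).choose_spec.1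

theorem leviCivita_isMetricCompatible :
    CovariantDerivative.IsMetricCompatible (V := fun x : M ↦ TangentSpace I x)
      (leviCivita I M) :=
  (exists_leviCivita I M).choose_spec.2

/-- A torsion-free metric connection satisfies the Koszul formula. -/
theorem koszul_formula (cov : CovariantDerivative I E (fun x : M ↦ TangentSpace I x))
    (ht : cov.torsion = 0)
    (hm : CovariantDerivative.IsMetricCompatible (V := fun x : M ↦ TangentSpace I x) cov)
    {X Y Z : Π x : M, TangentSpace I x} {x : M}
    (hX : MDiffAt (T% X) x) (hY : MDiffAt (T% Y) x) (hZ : MDiffAt (T% Z) x) :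
    2 * inner ℝ (cov Y x (X x)) (Z x) = koszul Y X Z x := by
  rw [CovariantDerivative.torsion_eq_zero_iff] at ht
  have m1 := hm.mvfderiv_inner_eq X hY hZ
  have m2 := hm.mvfderiv_inner_eq Y hX hZ
  have m3 := hm.mvfderiv_inner_eq Z hX hY
  simp only [koszul, m1, m2, m3, ← ht hX hY, ← ht hX hZ, ← ht hY hZ, inner_sub_left]
  rw [real_inner_comm (cov Z x (X x)) (Y x), real_inner_comm (cov Z x (Y x)) (X x),
    real_inner_comm (cov Y x (Z x)) (X x)]
  ring

/-- The Levi-Civita connection is the only torsion-free metric connection (on fields that are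
differentiable at the point). -/
theorem eq_leviCivita (cov : CovariantDerivative I E (fun x : M ↦ TangentSpace I x))
    (ht : cov.torsion = 0)
    (hm : CovariantDerivative.IsMetricCompatible (V := fun x : M ↦ TangentSpace I x) cov)
    {Y : Π x : M, TangentSpace I x} {x : M} (hY : MDiffAt (T% Y) x) :
    cov Y x = leviCivita I M Y x := by
  ext X
  refine ext_extend fun Z hZ ↦ ?_
  have hX : MDiffAt (T% (FiberBundle.extend E X)) x := FiberBundle.mdifferentiableAt_extend ..
  have h1 := koszul_formula cov ht hm hX hY hZ
  have h2 := koszul_formula _ leviCivita_torsion leviCivita_isMetricCompatible hX hY hZ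
  rw [FiberBundle.extend_apply_self] at h1 h2
  linarith

/-- The curvature `Rm(X, Y)Z = ∇_X ∇_Y Z - ∇_Y ∇_X Z - ∇_[X,Y] Z` of vector fields. -/
def curvature (X Y Z : Π x : M, TangentSpace I x) (x : M) : TangentSpace I x :=
  leviCivita I M (fun y ↦ leviCivita I M Z y (Y y)) x (X x)
    - leviCivita I M (fun y ↦ leviCivita I M Z y (X y)) x (Y x)
    - leviCivita I M Z x (mlieBracket I X Y x)

/-- The Riemann curvature tensor at `x`: the curvature of vector fields that are smooth near `x`
and have the given values at `x` (by tensoriality it does not depend on which ones). -/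
def riemann (x : M) (u v w : TangentSpace I x) : TangentSpace I x :=
  curvature (FiberBundle.extend E u) (FiberBundle.extend E v) (FiberBundle.extend E w) x

/-- The Ricci curvature: `Ric(v, w)` is the trace of `u ↦ Rm(u, v)w`. -/
def ricci (x : M) (v w : TangentSpace I x) : ℝ :=
  have := finDim_tangentSpace (I := I) x
  let e := stdOrthonormalBasis ℝ (TangentSpace I x)
  ∑ i, inner ℝ (riemann x (e i) v w) (e i)

variable (I) in
/-- The scalar curvature: the trace of the Ricci curvature with respect to the metric. -/
def scalarCurvature (x : M) : ℝ :=
  have := finDim_tangentSpace (I := I) x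
  let e := stdOrthonormalBasis ℝ (TangentSpace I x)
  ∑ i, ricci x (e i) (e i)

/-- The Lie derivative of the metric,
`(L_v g)(X, Y) = v⟨X, Y⟩ - ⟨[v, X], Y⟩ - ⟨X, [v, Y]⟩`. -/
def lieDerivMetric (v X Y : Π x : M, TangentSpace I x) (x : M) : ℝ :=
  mvfderiv I (fun y ↦ inner ℝ (X y) (Y y)) x (v x)
    - inner ℝ (mlieBracket I v X x) (Y x) - inner ℝ (X x) (mlieBracket I v Y x)

/-- `(M, g, v, ρ)` is a Yamabe soliton: `v` is a smooth vector field, `ρ` a constant, and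
`(R - ρ) g = (1/2) L_v g`. -/
structure IsYamabeSoliton (v : Π x : M, TangentSpace I x) (ρ : ℝ) : Prop where
  smooth : CMDiff ∞ (T% v)
  eq : ∀ (x : M) (X Y : Π x : M, TangentSpace I x),
    CMDiffAt ∞ (T% X) x → CMDiffAt ∞ (T% Y) x →
      (scalarCurvature I x - ρ) * inner ℝ (X x) (Y x) = 1 / 2 * lieDerivMetric v X Y x

/-- `v` is the gradient of `f` with respect to the metric. -/
def IsGradient (v : Π x : M, TangentSpace I x) (f : M → ℝ) : Prop :=
  ∀ (x : M) (X : TangentSpace I x), inner ℝ (v x) X = mvfderiv I f x X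

/-- The Yamabe soliton `(M, g, v, ρ)` is a gradient Yamabe soliton. -/
def IsGradientYamabeSoliton (v : Π x : M, TangentSpace I x) (ρ : ℝ) : Prop :=
  IsYamabeSoliton v ρ ∧ ∃ f : M → ℝ, CMDiff ∞ f ∧ IsGradient v f

/-- `(M, g, v, ρ)` is an expanding Yamabe soliton. -/
def IsExpandingYamabeSoliton (v : Π x : M, TangentSpace I x) (ρ : ℝ) : Prop :=
  IsYamabeSoliton v ρ ∧ ρ < 0

/-- `v` is a concurrent vector field: `∇_X v = X` for every tangent vector `X`. -/
structure IsConcurrent (v : Π x : M, TangentSpace I x) : Prop where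
  smooth : CMDiff ∞ (T% v)
  eq : ∀ (x : M) (X : TangentSpace I x), leviCivita I M v x X = X

end Defs

end YamabeSoliton

end

/-! A concurrent field satisfies `L_v g = 2g`, because `(L_v g)(X, Y) = ⟨∇_X v, Y⟩ + ⟨X, ∇_Y v⟩`.
The soliton equation then reads `R - ρ = 1`, so `R` is the constant `ρ + 1`. The field is the
gradient of `|v|²/2`, so only `R = 0` remains.

A homothety generated by `v` preserves the connection and rescales `R`. Infinitesimally this is
`v(R) = -2R`, which makes a constant `R` vanish. No flow is used: `∇v = id` and zero torsion give
`Rm(u, w)v = 0`, and the symmetries of the curvature tensor turn this into `Rm(v, u)w = 0`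
(`riemann_eq_zero_of_forall`). This is a commutation rule for `∇_v` and `∇_X`
(`IsConcurrent.nabla_nabla`); applied to each term of the curvature it gives `∇_v Rm = -2 Rm`
(`IsConcurrent.nabla_curvature`). Tracing in a smooth orthonormal frame gives `v(R) = -2R`
(`IsConcurrent.mvfderiv_scalarCurvature`); the derivatives of the frame cancel because they form a
skew matrix (`sum_bilin_skew`). -/

noncomputable section

namespace YamabeSoliton

open Filter Topology Module

/-! ### Vector fields smooth near a point -/

section SmoothFields

variable {E : Type*} [NormedAddCommGroup E] [NormedSpace ℝ E]
  {H : Type*} [TopologicalSpace H] {I : ModelWithCorners ℝ E H}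
  {M : Type*} [TopologicalSpace M] [ChartedSpace H M] [IsManifold I ∞ M]

/-- A vector field is smooth near `x` if it is smooth at every point of a neighborhood of `x`. -/
def SmoothNear (X : Π x : M, TangentSpace I x) (x : M) : Prop :=
  ∀ᶠ y in 𝓝 x, CMDiffAt ∞ (T% X) y

variable {X Y Z : Π x : M, TangentSpace I x} {f : M → ℝ} {x : M}

theorem SmoothNear.contMDiffAt (h : SmoothNear X x) : CMDiffAt ∞ (T% X) x := h.self_of_nhds

theorem SmoothNear.mdiff (h : SmoothNear X x) : MDiffAt (T% X) x :=
  h.contMDiffAt.mdifferentiableAt (by simp)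

theorem SmoothNear.eventually (h : SmoothNear X x) : ∀ᶠ y in 𝓝 x, SmoothNear X y :=
  eventually_eventually_nhds.2 h

theorem contMDiffAt_mvfderiv (hf : CMDiffAt ∞ f x) (hX : CMDiffAt ∞ (T% X) x) :
    CMDiffAt ∞ (fun y ↦ mvfderiv I f y (X y)) x := by
  have h1 := ContMDiffAt.mfderiv_const (m := ∞) hf (by simp)
  have h2 := ContMDiffAt.clm_apply_of_inCoordinates (b₁ := fun y : M ↦ y) (b₂ := f)
    (E₁ := fun y : M ↦ TangentSpace I y) (E₂ := fun y : ℝ ↦ TangentSpace 𝓘(ℝ, ℝ) y)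
    (ϕ := fun y ↦ mfderiv I 𝓘(ℝ, ℝ) f y) h1 hX hf
  -- `h2` is smoothness into the tangent bundle of `ℝ`; the fibre coordinate is the derivative
  -- itself.
  exact (contMDiff_snd_tangentBundle_modelSpace ℝ 𝓘(ℝ, ℝ)).contMDiffAt.comp x h2

theorem contMDiffAt_mlieBracket [CompleteSpace E] (hX : CMDiffAt ∞ (T% X) x)
    (hY : CMDiffAt ∞ (T% Y) x) : CMDiffAt ∞ (T% (mlieBracket I X Y)) x :=
  haveI : IsManifold I (((⊤ : ℕ∞) : ℕ∞ω) + 1) M := ‹IsManifold I ∞ M›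
  haveI : IsManifold I (minSmoothness ℝ 2) M := by
    rw [minSmoothness_of_isRCLikeNormedField]; infer_instance
  ContMDiffAt.mlieBracket_vectorField (m := ⊤) (n := ⊤) hX hY (by simp)

theorem SmoothNear.add (hX : SmoothNear X x) (hY : SmoothNear Y x) : SmoothNear (X + Y) x := by
  filter_upwards [hX, hY] with y h1 h2 using h1.add_section h2

theorem SmoothNear.sub (hX : SmoothNear X x) (hY : SmoothNear Y x) : SmoothNear (X - Y) x := by
  filter_upwards [hX, hY] with y h1 h2 using h1.sub_section h2

theorem SmoothNear.smul (hf : ∀ᶠ y in 𝓝 x, CMDiffAt ∞ f y) (hX : SmoothNear X x) :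
    SmoothNear (f • X) x := by
  filter_upwards [hf, hX] with y h1 h2 using h1.smul_section h2

theorem SmoothNear.sum {ι : Type*} {s : Finset ι} {X : ι → Π x : M, TangentSpace I x}
    (hX : ∀ i ∈ s, SmoothNear (X i) x) : SmoothNear (∑ i ∈ s, X i) x := by
  have : ∀ᶠ y in 𝓝 x, ∀ i ∈ s, CMDiffAt ∞ (T% (X i)) y := (Finset.eventually_all s).2 hX
  filter_upwards [this] with y h
  convert ContMDiffAt.sum_section h using 2
  simp

theorem SmoothNear.mlieBracket [CompleteSpace E] (hX : SmoothNear X x) (hY : SmoothNear Y x) :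
    SmoothNear (mlieBracket I X Y) x := by
  filter_upwards [hX, hY] with y h1 h2 using contMDiffAt_mlieBracket h1 h2

theorem SmoothNear.congr (hX : SmoothNear X x) (h : X =ᶠ[𝓝 x] Y) : SmoothNear Y x := by
  filter_upwards [hX, h.eventuallyEq_nhds] with y h1 h2
  refine h1.congr_of_eventuallyEq ?_
  filter_upwards [h2] with z hz
  rw [hz]

theorem smoothNear_extend (u : TangentSpace I x) : SmoothNear (FiberBundle.extend E u) x := by
  obtain ⟨s, hs, h⟩ := FiberBundle.exists_contMDiffOn_extend (k := ∞) I E u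
  filter_upwards [eventually_mem_nhds_iff.2 hs] with y hy
  exact h.contMDiffAt hy

end SmoothFields

/-! ### Smooth orthonormal frames -/

section Frames

set_option linter.unusedSectionVars false

variable {E : Type*} [NormedAddCommGroup E] [NormedSpace ℝ E] [FiniteDimensional ℝ E]
  {H : Type*} [TopologicalSpace H] {I : ModelWithCorners ℝ E H}
  {M : Type*} [TopologicalSpace M] [ChartedSpace H M] [IsManifold I ∞ M]
  [RiemannianBundle (fun x : M ↦ TangentSpace I x)]
  [IsContMDiffRiemannianBundle I ∞ E (fun x : M ↦ TangentSpace I x)]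
  {X Y Z : Π x : M, TangentSpace I x} {x : M}

theorem contMDiffAt_inner (hX : CMDiffAt ∞ (T% X) x) (hY : CMDiffAt ∞ (T% Y) x) :
    CMDiffAt ∞ (fun y ↦ inner ℝ (X y) (Y y)) x :=
  ContMDiffAt.inner_bundle (E := fun x : M ↦ TangentSpace I x) hX hY

/-- Gram–Schmidt is rational in the inner products, with denominators `⟨G k, G k⟩`. Independence at
the single point `x` keeps these nonzero at `x`, which suffices for smoothness there. -/
theorem contMDiffAt_gramSchmidt {ι : Type*} [LinearOrder ι] [LocallyFiniteOrderBot ι]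
    [WellFoundedLT ι] {s : ι → Π y : M, TangentSpace I y} (hs : ∀ i, CMDiffAt ∞ (T% (s i)) x)
    (hli : LinearIndependent ℝ (fun i ↦ s i x)) (i : ι) :
    CMDiffAt ∞ (T% (fun y ↦ InnerProductSpace.gramSchmidt ℝ (fun j ↦ s j y) i)) x := by
  induction i using WellFoundedLT.induction with
  | ind i ih =>
    let G (k : ι) (y : M) : TangentSpace I y :=
      InnerProductSpace.gramSchmidt ℝ (fun j ↦ s j y) k
    have h : G i = s i - fun y ↦ ∑ k ∈ Finset.Iio i,
        (inner ℝ (G k y) (s i y) / inner ℝ (G k y) (G k y)) • G k y := by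
      funext y
      have := InnerProductSpace.gramSchmidt_def'' ℝ (fun j ↦ s j y) i
      simp only [Pi.sub_apply]
      rw [eq_sub_iff_add_eq]
      simp only [real_inner_self_eq_norm_sq]
      exact this.symm
    change CMDiffAt ∞ (T% (G i)) x
    rw [h]
    refine (hs i).sub_section (ContMDiffAt.sum_section fun k hk ↦ ?_)
    have hk' := ih k (Finset.mem_Iio.1 hk)
    refine ContMDiffAt.smul_section (ContMDiffAt.div₀ (contMDiffAt_inner hk' (hs i))
      (contMDiffAt_inner hk' hk') ?_) hk'
    rw [inner_self_ne_zero]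
    exact InnerProductSpace.gramSchmidt_ne_zero _ hli

theorem contMDiffAt_gramSchmidtNormed {ι : Type*} [LinearOrder ι] [LocallyFiniteOrderBot ι]
    [WellFoundedLT ι] {s : ι → Π y : M, TangentSpace I y} (hs : ∀ i, CMDiffAt ∞ (T% (s i)) x)
    (hli : LinearIndependent ℝ (fun i ↦ s i x)) (i : ι) :
    CMDiffAt ∞ (T% (fun y ↦ InnerProductSpace.gramSchmidtNormed ℝ (fun j ↦ s j y) i)) x := by
  have h := contMDiffAt_gramSchmidt hs hli i
  have h0 := InnerProductSpace.gramSchmidt_ne_zero i hli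
  have h1 : CMDiffAt ∞ (fun y ↦ (‖InnerProductSpace.gramSchmidt ℝ (fun j ↦ s j y) i‖)⁻¹) x := by
    have h2 := contMDiffAt_inner h h
    simp only [real_inner_self_eq_norm_sq] at h2
    have h3 : CMDiffAt ∞ (fun y ↦ ‖InnerProductSpace.gramSchmidt ℝ (fun j ↦ s j y) i‖) x := by
      have := (Real.contDiffAt_sqrt (n := ∞)
        (pow_ne_zero 2 (norm_ne_zero_iff.2 h0))).contMDiffAt.comp x h2
      refine this.congr_of_eventuallyEq (Eventually.of_forall fun y ↦ ?_)
      simp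
    exact h3.inv₀ (norm_ne_zero_iff.2 h0)
  exact h1.smul_section h

variable (I) in
/-- Near every point of a Riemannian manifold there is a smooth orthonormal frame. -/
theorem exists_orthonormalFrame (x : M) :
    ∃ e : Fin (finrank ℝ E) → Π y : M, TangentSpace I y,
      (∀ i, SmoothNear (e i) x) ∧ ∀ᶠ y in 𝓝 x, Orthonormal ℝ (fun i ↦ e i y) := by
  set t := trivializationAt E (fun x : M ↦ TangentSpace I x) x
  have ht := t.isLocalFrameOn_localFrame_baseSet I ∞ (finBasis ℝ E)
  have hx : t.baseSet ∈ 𝓝 x :=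
    t.open_baseSet.mem_nhds (FiberBundle.mem_baseSet_trivializationAt' x)
  refine ⟨fun i y ↦ InnerProductSpace.gramSchmidtNormed ℝ
    (fun j ↦ t.localFrame (finBasis ℝ E) j y) i, fun i ↦ ?_, ?_⟩
  · filter_upwards [hx] with y hy
    exact contMDiffAt_gramSchmidtNormed (fun i ↦ ht.contMDiffAt t.open_baseSet hy i)
      (ht.linearIndependent hy) i
  · filter_upwards [hx] with y hy
    exact InnerProductSpace.gramSchmidtNormed_orthonormal (ht.linearIndependent hy)

/-- An orthonormal family of `dim M` tangent vectors is an orthonormal basis. -/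
def orthonormalBasisOfOrthonormal {e : Fin (finrank ℝ E) → TangentSpace I x}
    (he : Orthonormal ℝ e) : OrthonormalBasis (Fin (finrank ℝ E)) ℝ (TangentSpace I x) :=
  haveI := finDim_tangentSpace (I := I) x
  OrthonormalBasis.mk he (he.linearIndependent.span_eq_top_of_card_eq_finrank'
    (by rw [Fintype.card_fin]; rfl)).ge

theorem sum_inner_smul_of_orthonormal {e : Fin (finrank ℝ E) → TangentSpace I x}
    (he : Orthonormal ℝ e) (u : TangentSpace I x) : ∑ i, inner ℝ (e i) u • e i = u := by
  simpa [orthonormalBasisOfOrthonormal] using (orthonormalBasisOfOrthonormal he).sum_repr' u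

/-- Smoothness can be tested on the components in an orthonormal frame; this is how `∇_X Y` is shown
to be smooth. -/
theorem smoothNear_of_inner {e : Fin (finrank ℝ E) → Π y : M, TangentSpace I y}
    (hs : ∀ i, SmoothNear (e i) x) (he : ∀ᶠ y in 𝓝 x, Orthonormal ℝ (fun i ↦ e i y))
    (hX : ∀ i, ∀ᶠ y in 𝓝 x, CMDiffAt ∞ (fun y ↦ inner ℝ (e i y) (X y)) y) :
    SmoothNear X x := by
  have h : SmoothNear (∑ i, (fun y ↦ inner ℝ (e i y) (X y)) • e i) x :=
    SmoothNear.sum fun i _ ↦ SmoothNear.smul (hX i) (hs i)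
  refine h.congr ?_
  filter_upwards [he] with y hy
  rw [Finset.sum_apply]
  exact sum_inner_smul_of_orthonormal hy (X y)

end Frames

/-! ### The Levi-Civita connection on smooth fields -/

section Connection

set_option linter.unusedSectionVars false

variable {E : Type*} [NormedAddCommGroup E] [NormedSpace ℝ E] [FiniteDimensional ℝ E]
  {H : Type*} [TopologicalSpace H] {I : ModelWithCorners ℝ E H}
  {M : Type*} [TopologicalSpace M] [ChartedSpace H M] [IsManifold I ∞ M]
  [RiemannianBundle (fun x : M ↦ TangentSpace I x)]
  [IsContMDiffRiemannianBundle I ∞ E (fun x : M ↦ TangentSpace I x)]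
  {X Y Z W : Π x : M, TangentSpace I x} {f : M → ℝ} {x : M}

theorem mvfderiv_congr {f g : M → ℝ} (h : f =ᶠ[𝓝 x] g) (u : TangentSpace I x) :
    mvfderiv I f x u = mvfderiv I g x u := by
  change (mfderiv I 𝓘(ℝ, ℝ) f x u : ℝ) = (mfderiv I 𝓘(ℝ, ℝ) g x u : ℝ)
  exact congr($(h.mfderiv_eq) u)

/-- The Jacobi identity, for vector fields that are smooth near a point. -/
theorem mlieBracket_jacobi (hX : SmoothNear X x) (hY : SmoothNear Y x) (hZ : SmoothNear Z x) :
    mlieBracket I X (mlieBracket I Y Z) x =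
      mlieBracket I (mlieBracket I X Y) Z x + mlieBracket I Y (mlieBracket I X Z) x := by
  have : IsManifold I (minSmoothness ℝ 3) M := by
    rw [minSmoothness_of_isRCLikeNormedField]; infer_instance
  have h2 : minSmoothness ℝ 2 ≤ (∞ : ℕ∞ω) := by
    rw [minSmoothness_of_isRCLikeNormedField]
    exact ENat.LEInfty.out
  exact leibniz_identity_mlieBracket_apply (hX.contMDiffAt.of_le h2) (hY.contMDiffAt.of_le h2)
    (hZ.contMDiffAt.of_le h2)

/-- Commutator formula: `X(Yf) - Y(Xf) = [X, Y]f`. -/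
theorem mvfderiv_mvfderiv_sub (hf : ∀ᶠ y in 𝓝 x, CMDiffAt ∞ f y) (hX : SmoothNear X x)
    (hY : SmoothNear Y x) :
    mvfderiv I (fun y ↦ mvfderiv I f y (Y y)) x (X x)
      - mvfderiv I (fun y ↦ mvfderiv I f y (X y)) x (Y x)
      = mvfderiv I f x (mlieBracket I X Y x) := by
  rcases subsingleton_or_nontrivial (TangentSpace I x) with h | h
  · rw [Subsingleton.elim (X x) 0, Subsingleton.elim (Y x) 0,
      Subsingleton.elim (mlieBracket I X Y x) 0]
    simp
  -- The formula is extracted from the Jacobi identity for `X`, `Y`, `fZ`: after expanding with the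
  -- Leibniz rule and subtracting `f` times the identity for `X`, `Y`, `Z`, what is left is the
  -- claimed difference times `Z x`, and `Z x ≠ 0`.
  obtain ⟨z, hz⟩ := exists_ne (0 : TangentSpace I x)
  set Z : Π y : M, TangentSpace I y := FiberBundle.extend E z with hZdef
  have hZ : SmoothNear Z x := smoothNear_extend z
  have hZx : Z x = z := FiberBundle.extend_apply_self E z
  have expand : ∀ {A : Π y : M, TangentSpace I y}, SmoothNear A x →
      mlieBracket I A (f • Z) =ᶠ[𝓝 x]
        (fun y ↦ mvfderiv I f y (A y)) • Z + f • mlieBracket I A Z := by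
    intro A hA
    filter_upwards [hf, hZ] with y h1 h2
    exact mlieBracket_smul_right (h1.mdifferentiableAt (by simp)) (h2.mdifferentiableAt (by simp))
  have two : ∀ {A B : Π y : M, TangentSpace I y}, SmoothNear A x → SmoothNear B x →
      mlieBracket I A (mlieBracket I B (f • Z)) x
        = mvfderiv I (fun y ↦ mvfderiv I f y (B y)) x (A x) • z
          + mvfderiv I f x (B x) • mlieBracket I A Z x
          + (mvfderiv I f x (A x) • mlieBracket I B Z x
            + f x • mlieBracket I A (mlieBracket I B Z) x) := by
    intro A B hA hB
    have hBf : ∀ᶠ y in 𝓝 x, CMDiffAt ∞ (fun y ↦ mvfderiv I f y (B y)) y := by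
      filter_upwards [hf, hB] with y h1 h2 using contMDiffAt_mvfderiv h1 h2
    rw [EventuallyEq.mlieBracket_vectorField_eq (EventuallyEq.refl _ A) (expand hB),
      mlieBracket_add_right (SmoothNear.smul hBf hZ).mdiff
        (SmoothNear.smul hf (hB.mlieBracket hZ)).mdiff,
      mlieBracket_smul_right (hBf.self_of_nhds.mdifferentiableAt (by simp)) hZ.mdiff,
      mlieBracket_smul_right (hf.self_of_nhds.mdifferentiableAt (by simp))
        (hB.mlieBracket hZ).mdiff, hZx]
  have j1 := mlieBracket_jacobi hX hY (SmoothNear.smul hf hZ)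
  have j2 := mlieBracket_jacobi hX hY hZ
  rw [two hX hY, two hY hX, (expand (hX.mlieBracket hY)).self_of_nhds, j2] at j1
  simp only [Pi.add_apply, Pi.smul_apply', hZx, smul_add] at j1
  have h0 : (mvfderiv I (fun y ↦ mvfderiv I f y (Y y)) x (X x)
      - mvfderiv I (fun y ↦ mvfderiv I f y (X y)) x (Y x)
      - mvfderiv I f x (mlieBracket I X Y x)) • z = 0 := by
    rw [← sub_eq_zero] at j1
    rw [← j1]
    module
  linarith [(smul_eq_zero.1 h0).resolve_right hz]

/-- The covariant derivative `∇_X Y` of the Levi-Civita connection. -/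
def nabla (X Y : Π x : M, TangentSpace I x) (x : M) : TangentSpace I x :=
  leviCivita I M Y x (X x)

theorem curvature_eq (X Y Z : Π x : M, TangentSpace I x) (x : M) :
    curvature X Y Z x = nabla X (nabla Y Z) x - nabla Y (nabla X Z) x
      - nabla (mlieBracket I X Y) Z x := rfl

theorem contMDiffAt_koszul (hX : CMDiffAt ∞ (T% X) x) (hY : CMDiffAt ∞ (T% Y) x)
    (hZ : CMDiffAt ∞ (T% Z) x) : CMDiffAt ∞ (koszul Y X Z) x := by
  have h1 := contMDiffAt_mvfderiv (contMDiffAt_inner hY hZ) hX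
  have h2 := contMDiffAt_mvfderiv (contMDiffAt_inner hX hZ) hY
  have h3 := contMDiffAt_mvfderiv (contMDiffAt_inner hX hY) hZ
  have h4 := contMDiffAt_inner (contMDiffAt_mlieBracket hX hY) hZ
  have h5 := contMDiffAt_inner (contMDiffAt_mlieBracket hX hZ) hY
  have h6 := contMDiffAt_inner (contMDiffAt_mlieBracket hY hZ) hX
  exact ((((h1.add h2).sub h3).add h4).sub h5).sub h6

/-- `leviCivita` comes from an existence statement that says nothing about smoothness. The Koszul
formula expresses the frame components of `∇_X Y` by smooth functions. -/
theorem SmoothNear.nabla (hX : SmoothNear X x) (hY : SmoothNear Y x) :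
    SmoothNear (nabla X Y) x := by
  obtain ⟨e, hs, he⟩ := exists_orthonormalFrame I x
  refine smoothNear_of_inner hs he fun i ↦ ?_
  filter_upwards [hX.eventually, hY.eventually, (hs i).eventually] with y h1 h2 h3
  have h4 : CMDiffAt ∞ (fun z ↦ (1 / 2 : ℝ) * koszul Y X (e i) z) y :=
    contMDiffAt_const.mul (contMDiffAt_koszul h1.contMDiffAt h2.contMDiffAt h3.contMDiffAt)
  refine h4.congr_of_eventuallyEq ?_
  filter_upwards [h1.eventually, h2.eventually, h3.eventually] with z k1 k2 k3
  have := koszul_formula _ leviCivita_torsion leviCivita_isMetricCompatible k1.mdiff k2.mdiff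
    k3.mdiff
  rw [← this, real_inner_comm]
  simp [YamabeSoliton.nabla]

theorem nabla_congr {X' Y' : Π x : M, TangentSpace I x} (hX : X x = X' x) (hY : SmoothNear Y x)
    (h : Y =ᶠ[𝓝 x] Y') : nabla X Y x = nabla X' Y' x := by
  have := (leviCivita I M).isCovariantDerivativeOnUniv.congr_of_eventuallyEq hY.mdiff
    (hY.congr h).mdiff univ_mem h
  unfold nabla
  rw [← hX]
  exact congr($this (X x))

theorem nabla_add_left (X X' Y : Π x : M, TangentSpace I x) :
    nabla (X + X') Y = nabla X Y + nabla X' Y := by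
  funext y
  exact map_add _ _ _

theorem nabla_smul_left (f : M → ℝ) (X Y : Π x : M, TangentSpace I x) :
    nabla (f • X) Y = f • nabla X Y := by
  funext y
  exact map_smul _ _ _

theorem nabla_neg_left (X Y : Π x : M, TangentSpace I x) : nabla (-X) Y = -nabla X Y := by
  funext y
  exact map_neg _ _

theorem nabla_add_right (X : Π x : M, TangentSpace I x) (hY : MDiffAt (T% Y) x)
    (hZ : MDiffAt (T% Z) x) : nabla X (Y + Z) x = nabla X Y x + nabla X Z x :=
  congr($((leviCivita I M).isCovariantDerivativeOnUniv.add hY hZ) (X x))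

theorem nabla_smul_right (X : Π x : M, TangentSpace I x) (hf : MDiffAt f x)
    (hY : MDiffAt (T% Y) x) :
    nabla X (f • Y) x = f x • nabla X Y x + mvfderiv I f x (X x) • Y x :=
  congr($((leviCivita I M).isCovariantDerivativeOnUniv.leibniz hY hf) (X x))

theorem nabla_sub_right (X : Π x : M, TangentSpace I x) (hY : MDiffAt (T% Y) x)
    (hZ : MDiffAt (T% Z) x) : nabla X (Y - Z) x = nabla X Y x - nabla X Z x := by
  rw [eq_sub_iff_add_eq, ← nabla_add_right X (mdifferentiableAt_sub_section hY hZ) hZ,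
    sub_add_cancel]

theorem nabla_sub_nabla (hX : MDiffAt (T% X) x) (hY : MDiffAt (T% Y) x) :
    nabla X Y x - nabla Y X x = mlieBracket I X Y x :=
  ((CovariantDerivative.torsion_eq_zero_iff _).1 (leviCivita_torsion (I := I) (M := M))) hX hY

theorem mvfderiv_inner_eq (X : Π x : M, TangentSpace I x) (hY : MDiffAt (T% Y) x)
    (hZ : MDiffAt (T% Z) x) :
    mvfderiv I (fun y ↦ inner ℝ (Y y) (Z y)) x (X x)
      = inner ℝ (nabla X Y x) (Z x) + inner ℝ (Y x) (nabla X Z x) :=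
  leviCivita_isMetricCompatible.mvfderiv_inner_eq X hY hZ

end Connection

/-! ### Tensoriality and symmetries of the curvature -/

section Curvature

set_option linter.unusedSectionVars false

variable {E : Type*} [NormedAddCommGroup E] [NormedSpace ℝ E] [FiniteDimensional ℝ E]
  {H : Type*} [TopologicalSpace H] {I : ModelWithCorners ℝ E H}
  {M : Type*} [TopologicalSpace M] [ChartedSpace H M] [IsManifold I ∞ M]
  [RiemannianBundle (fun x : M ↦ TangentSpace I x)]
  [IsContMDiffRiemannianBundle I ∞ E (fun x : M ↦ TangentSpace I x)]
  {X Y Z W X' Y' Z' : Π x : M, TangentSpace I x} {f : M → ℝ} {x : M}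

/-- A map on vector fields that is local and linear over the smooth functions only depends on
the value of the field at the point. -/
theorem eq_of_tensorial {A : Type*} [AddCommGroup A] [Module ℝ A]
    (Φ : (Π y : M, TangentSpace I y) → A)
    (hadd : ∀ X Y, SmoothNear X x → SmoothNear Y x → Φ (X + Y) = Φ X + Φ Y)
    (hsmul : ∀ (f : M → ℝ) X, (∀ᶠ y in 𝓝 x, CMDiffAt ∞ f y) → SmoothNear X x →
      Φ (f • X) = f x • Φ X)
    (hcongr : ∀ X Y, SmoothNear X x → X =ᶠ[𝓝 x] Y → Φ X = Φ Y)
    (hX : SmoothNear X x) (hY : SmoothNear Y x) (h : X x = Y x) : Φ X = Φ Y := by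
  obtain ⟨e, hs, he⟩ := exists_orthonormalFrame I x
  have key : ∀ W : Π y : M, TangentSpace I y, SmoothNear W x →
      Φ W = ∑ i, inner ℝ (e i x) (W x) • Φ (e i) := by
    intro W hW
    have hc : ∀ i, ∀ᶠ y in 𝓝 x, CMDiffAt ∞ (fun y ↦ inner ℝ (e i y) (W y)) y := by
      intro i
      filter_upwards [hs i, hW] with y h1 h2 using contMDiffAt_inner h1 h2
    have hsum : ∀ s : Finset (Fin (finrank ℝ E)),
        Φ (∑ i ∈ s, (fun y ↦ inner ℝ (e i y) (W y)) • e i)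
          = ∑ i ∈ s, inner ℝ (e i x) (W x) • Φ (e i) := by
      intro s
      induction s using Finset.induction_on with
      | empty =>
        -- Additivity is only assumed on smooth fields, so `Φ 0 = 0` is read off from `0 • W`.
        have h0 := hsmul 0 W (Eventually.of_forall fun y ↦ contMDiffAt_const) hW
        simpa using h0
      | insert i s hi ih =>
        rw [Finset.sum_insert hi, Finset.sum_insert hi, ← ih,
          hadd _ _ (SmoothNear.smul (hc i) (hs i))
            (SmoothNear.sum fun j _ ↦ SmoothNear.smul (hc j) (hs j)),
          hsmul _ _ (hc i) (hs i)]
    rw [← hsum]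
    refine hcongr _ _ hW ?_
    filter_upwards [he] with y hy
    rw [Finset.sum_apply]
    exact (sum_inner_smul_of_orthonormal hy (W y)).symm
  rw [key X hX, key Y hY, h]

theorem SmoothNear.curvature (hX : SmoothNear X x) (hY : SmoothNear Y x) (hZ : SmoothNear Z x) :
    SmoothNear (curvature X Y Z) x :=
  ((hX.nabla (hY.nabla hZ)).sub (hY.nabla (hX.nabla hZ))).sub ((hX.mlieBracket hY).nabla hZ)

theorem curvature_swap (X Y Z : Π x : M, TangentSpace I x) (x : M) :
    curvature X Y Z x = -curvature Y X Z x := by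
  simp only [curvature_eq]
  rw [mlieBracket_swap (V := X), nabla_neg_left]
  simp only [Pi.neg_apply]
  abel

theorem curvature_add_left (hX : SmoothNear X x) (hX' : SmoothNear X' x)
    (hZ : SmoothNear Z x) :
    curvature (X + X') Y Z x = curvature X Y Z x + curvature X' Y Z x := by
  have h1 := nabla_add_right Y (hX.nabla hZ).mdiff (hX'.nabla hZ).mdiff
  have h2 : nabla (mlieBracket I (X + X') Y) Z x
      = nabla (mlieBracket I X Y + mlieBracket I X' Y) Z x :=
    nabla_congr (mlieBracket_add_left hX.mdiff hX'.mdiff) hZ (EventuallyEq.refl _ _)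
  simp only [curvature_eq, h2, nabla_add_left, h1, Pi.add_apply]
  abel

/-- The term `Y(f) ∇_X Z` arises from `∇_Y (f ∇_X Z)` and from `[fX, Y]`, and the two cancel. -/
theorem curvature_smul_left (hf : ∀ᶠ y in 𝓝 x, CMDiffAt ∞ f y) (hX : SmoothNear X x)
    (hZ : SmoothNear Z x) :
    curvature (f • X) Y Z x = f x • curvature X Y Z x := by
  have hfx : MDiffAt f x := hf.self_of_nhds.mdifferentiableAt (by simp)
  have h1 := nabla_smul_right Y hfx (hX.nabla hZ).mdiff
  have h2 : nabla (mlieBracket I (f • X) Y) Z x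
      = nabla ((fun y ↦ -mvfderiv I f y (Y y)) • X + f • mlieBracket I X Y) Z x :=
    nabla_congr (mlieBracket_smul_left hfx hX.mdiff) hZ (EventuallyEq.refl _ _)
  simp only [curvature_eq, h2, nabla_add_left, nabla_smul_left, h1, Pi.add_apply, Pi.smul_apply']
  module

theorem curvature_congr_left (h : X =ᶠ[𝓝 x] X') (hX : SmoothNear X x) (hY : SmoothNear Y x)
    (hZ : SmoothNear Z x) : curvature X Y Z x = curvature X' Y Z x := by
  have h1 : nabla X Z =ᶠ[𝓝 x] nabla X' Z := by
    filter_upwards [h, hZ.eventually] with y h1 h2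
    exact nabla_congr h1 h2 (EventuallyEq.refl _ _)
  have h2 := EventuallyEq.mlieBracket_vectorField_eq (I := I) h (EventuallyEq.refl _ Y)
  rw [curvature_eq, curvature_eq,
    nabla_congr (X := X) h.self_of_nhds (hY.nabla hZ) (EventuallyEq.refl _ _),
    nabla_congr (Y := nabla X Z) rfl (hX.nabla hZ) h1,
    nabla_congr (X := mlieBracket I X Y) h2 hZ (EventuallyEq.refl _ _)]

theorem curvature_add_right (hX : SmoothNear X x) (hY : SmoothNear Y x)
    (hZ : SmoothNear Z x) (hZ' : SmoothNear Z' x) :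
    curvature X Y (Z + Z') x = curvature X Y Z x + curvature X Y Z' x := by
  have two : ∀ {A B : Π y : M, TangentSpace I y}, SmoothNear A x → SmoothNear B x →
      nabla A (nabla B (Z + Z')) x = nabla A (nabla B Z) x + nabla A (nabla B Z') x := by
    intro A B hA hB
    rw [← nabla_add_right A (hB.nabla hZ).mdiff (hB.nabla hZ').mdiff]
    refine nabla_congr rfl (hB.nabla (hZ.add hZ')) ?_
    filter_upwards [hZ.eventually, hZ'.eventually] with y h1 h2
    exact nabla_add_right B h1.mdiff h2.mdiff
  rw [curvature_eq, two hX hY, two hY hX, nabla_add_right _ hZ.mdiff hZ'.mdiff]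
  simp only [curvature_eq]
  abel

/-- First-order terms in `f` are symmetric in `X` and `Y` and cancel; the second derivatives leave
`[X, Y]f`, which the bracket term removes. -/
theorem curvature_smul_right (hf : ∀ᶠ y in 𝓝 x, CMDiffAt ∞ f y) (hX : SmoothNear X x)
    (hY : SmoothNear Y x) (hZ : SmoothNear Z x) :
    curvature X Y (f • Z) x = f x • curvature X Y Z x := by
  have hfx : MDiffAt f x := hf.self_of_nhds.mdifferentiableAt (by simp)
  have two : ∀ {A B : Π y : M, TangentSpace I y}, SmoothNear A x → SmoothNear B x →
      nabla A (nabla B (f • Z)) x = f x • nabla A (nabla B Z) x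
        + mvfderiv I f x (A x) • nabla B Z x + (mvfderiv I f x (B x) • nabla A Z x
        + mvfderiv I (fun y ↦ mvfderiv I f y (B y)) x (A x) • Z x) := by
    intro A B hA hB
    have hBf : ∀ᶠ y in 𝓝 x, CMDiffAt ∞ (fun y ↦ mvfderiv I f y (B y)) y := by
      filter_upwards [hf, hB] with y h1 h2 using contMDiffAt_mvfderiv h1 h2
    have h1 : nabla B (f • Z) =ᶠ[𝓝 x]
        f • nabla B Z + (fun y ↦ mvfderiv I f y (B y)) • Z := by
      filter_upwards [hf, hZ.eventually] with y h1 h2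
      exact nabla_smul_right B (h1.mdifferentiableAt (by simp)) h2.mdiff
    rw [nabla_congr (X := A) rfl (hB.nabla (SmoothNear.smul hf hZ)) h1,
      nabla_add_right A (SmoothNear.smul hf (hB.nabla hZ)).mdiff (SmoothNear.smul hBf hZ).mdiff,
      nabla_smul_right A hfx (hB.nabla hZ).mdiff,
      nabla_smul_right A (hBf.self_of_nhds.mdifferentiableAt (by simp)) hZ.mdiff]
  rw [curvature_eq, two hX hY, two hY hX, nabla_smul_right _ hfx hZ.mdiff,
    ← mvfderiv_mvfderiv_sub hf hX hY]
  simp only [curvature_eq]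
  module

theorem curvature_congr_right (h : Z =ᶠ[𝓝 x] Z') (hX : SmoothNear X x) (hY : SmoothNear Y x)
    (hZ : SmoothNear Z x) : curvature X Y Z x = curvature X Y Z' x := by
  have h1 : ∀ A : Π y : M, TangentSpace I y, nabla A Z =ᶠ[𝓝 x] nabla A Z' := by
    intro A
    filter_upwards [h.eventuallyEq_nhds, hZ.eventually] with y h1 h2
    exact nabla_congr rfl h2 h1
  rw [curvature_eq, curvature_eq, nabla_congr (X := X) rfl (hY.nabla hZ) (h1 Y),
    nabla_congr (X := Y) rfl (hX.nabla hZ) (h1 X), nabla_congr rfl hZ h]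

/-- Curvature is a tensor: its value at a point only depends on the values of the vector fields
at that point. -/
theorem curvature_congr (hX : SmoothNear X x) (hY : SmoothNear Y x) (hZ : SmoothNear Z x)
    (hX' : SmoothNear X' x) (hY' : SmoothNear Y' x) (hZ' : SmoothNear Z' x)
    (h1 : X x = X' x) (h2 : Y x = Y' x) (h3 : Z x = Z' x) :
    curvature X Y Z x = curvature X' Y' Z' x := by
  have left : ∀ {A A' B C : Π y : M, TangentSpace I y}, SmoothNear A x → SmoothNear A' x →
      SmoothNear B x → SmoothNear C x → A x = A' x → curvature A B C x = curvature A' B C x :=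
    fun {A A' B C} hA hA' hB hC h ↦ eq_of_tensorial (fun A ↦ curvature A B C x)
      (fun _ _ k k' ↦ curvature_add_left k k' hC)
      (fun _ _ kf k ↦ curvature_smul_left kf k hC)
      (fun _ _ k kk ↦ curvature_congr_left kk k hB hC) hA hA' h
  -- The second slot is handled by swapping it into the first and swapping back.
  rw [left hX hX' hY hZ h1, curvature_swap, left hY hY' hX' hZ h2, ← curvature_swap]
  exact eq_of_tensorial (fun C ↦ curvature X' Y' C x)
      (fun _ _ k k' ↦ curvature_add_right hX' hY' k k')
      (fun _ _ kf k ↦ curvature_smul_right kf hX' hY' k)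
      (fun _ _ k kk ↦ curvature_congr_right kk hX' hY' k) hZ hZ' h3

theorem curvature_eq_riemann (hX : SmoothNear X x) (hY : SmoothNear Y x) (hZ : SmoothNear Z x) :
    curvature X Y Z x = riemann x (X x) (Y x) (Z x) :=
  curvature_congr hX hY hZ (smoothNear_extend _) (smoothNear_extend _) (smoothNear_extend _)
    (by simp) (by simp) (by simp)

theorem riemann_swap (x : M) (u v w : TangentSpace I x) :
    riemann x u v w = -riemann x v u w := curvature_swap _ _ _ _

/-- The sum of the chosen extensions need not be the chosen extension of the sum; tensoriality makes
the difference irrelevant. -/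
theorem riemann_add_left (x : M) (u u' v w : TangentSpace I x) :
    riemann x (u + u') v w = riemann x u v w + riemann x u' v w := by
  have h := curvature_add_left (smoothNear_extend u) (smoothNear_extend u')
    (smoothNear_extend w) (Y := FiberBundle.extend E v)
  rw [curvature_eq_riemann ((smoothNear_extend u).add (smoothNear_extend u'))
    (smoothNear_extend v) (smoothNear_extend w)] at h
  simpa using! h

theorem riemann_smul_left (x : M) (c : ℝ) (u v w : TangentSpace I x) :
    riemann x (c • u) v w = c • riemann x u v w := by
  have hc : ∀ᶠ y in 𝓝 x, ContMDiffAt I 𝓘(ℝ, ℝ) ∞ (fun _ : M ↦ c) y :=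
    Eventually.of_forall fun _ ↦ contMDiffAt_const
  have h := curvature_smul_left hc (smoothNear_extend u) (smoothNear_extend w)
    (Y := FiberBundle.extend E v)
  rw [curvature_eq_riemann (SmoothNear.smul hc (smoothNear_extend u))
    (smoothNear_extend v) (smoothNear_extend w)] at h
  simpa using! h

theorem riemann_add_middle (x : M) (u v v' w : TangentSpace I x) :
    riemann x u (v + v') w = riemann x u v w + riemann x u v' w := by
  rw [riemann_swap, riemann_add_left, riemann_swap x u v, riemann_swap x u v', neg_add]

theorem riemann_smul_middle (x : M) (c : ℝ) (u v w : TangentSpace I x) :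
    riemann x u (c • v) w = c • riemann x u v w := by
  rw [riemann_swap, riemann_smul_left, riemann_swap x u v, smul_neg]

theorem riemann_add_right (x : M) (u v w w' : TangentSpace I x) :
    riemann x u v (w + w') = riemann x u v w + riemann x u v w' := by
  have h := curvature_add_right (smoothNear_extend u) (smoothNear_extend v)
    (smoothNear_extend w) (smoothNear_extend w')
  rw [curvature_eq_riemann (smoothNear_extend u) (smoothNear_extend v)
    ((smoothNear_extend w).add (smoothNear_extend w'))] at h
  simpa using! h

theorem riemann_smul_right (x : M) (c : ℝ) (u v w : TangentSpace I x) :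
    riemann x u v (c • w) = c • riemann x u v w := by
  have hc : ∀ᶠ y in 𝓝 x, ContMDiffAt I 𝓘(ℝ, ℝ) ∞ (fun _ : M ↦ c) y :=
    Eventually.of_forall fun _ ↦ contMDiffAt_const
  have h := curvature_smul_right hc (smoothNear_extend u) (smoothNear_extend v)
    (smoothNear_extend w)
  rw [curvature_eq_riemann (smoothNear_extend u) (smoothNear_extend v)
    (SmoothNear.smul hc (smoothNear_extend w))] at h
  simpa using! h

/-- The first Bianchi identity. -/
theorem curvature_bianchi (hX : SmoothNear X x) (hY : SmoothNear Y x) (hZ : SmoothNear Z x) :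
    curvature X Y Z x + curvature Y Z X x + curvature Z X Y x = 0 := by
  -- Zero torsion, used twice, collapses each group of three terms to a double bracket; the cyclic
  -- sum of these vanishes by Jacobi.
  have two : ∀ {A B C : Π y : M, TangentSpace I y}, SmoothNear A x → SmoothNear B x →
      SmoothNear C x → nabla A (nabla B C) x - nabla A (nabla C B) x - nabla (mlieBracket I B C) A x
        = mlieBracket I A (mlieBracket I B C) x := by
    intro A B C hA hB hC
    rw [← nabla_sub_nabla hA.mdiff (hB.mlieBracket hC).mdiff,
      ← nabla_sub_right A (hB.nabla hC).mdiff (hC.nabla hB).mdiff]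
    congr 1
    refine nabla_congr rfl ((hB.nabla hC).sub (hC.nabla hB)) ?_
    filter_upwards [hB.eventually, hC.eventually] with y h1 h2
    exact nabla_sub_nabla h1.mdiff h2.mdiff
  have h1 := two hX hY hZ
  have h2 := two hY hZ hX
  have h3 := two hZ hX hY
  have hj := mlieBracket_jacobi hX hY hZ
  have s1 : mlieBracket I (mlieBracket I X Y) Z x = -mlieBracket I Z (mlieBracket I X Y) x :=
    mlieBracket_swap_apply
  have s2 : mlieBracket I Y (mlieBracket I X Z) x = -mlieBracket I Y (mlieBracket I Z X) x := by
    rw [mlieBracket_swap (V := X), ← neg_one_smul ℝ (mlieBracket I Z X),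
      mlieBracket_const_smul_right (hZ.mlieBracket hX).mdiff, neg_one_smul]
  rw [s1, s2, ← h1, ← h2, ← h3, ← sub_eq_zero] at hj
  rw [← hj]
  simp only [curvature_eq]
  abel

/-- `Rm(X, Y)` is skew-adjoint. -/
theorem inner_curvature_self (hX : SmoothNear X x) (hY : SmoothNear Y x) (hZ : SmoothNear Z x) :
    inner ℝ (curvature X Y Z x) (Z x) = 0 := by
  -- The commutator formula is applied to `|Z|²`. The products `⟨∇_X Z, ∇_Y Z⟩` are symmetric and
  -- drop out, leaving `2⟨Rm(X, Y)Z, Z⟩ = 0`.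
  have hf : ∀ᶠ y in 𝓝 x, CMDiffAt ∞ (fun y ↦ inner ℝ (Z y) (Z y)) y := by
    filter_upwards [hZ] with y h using contMDiffAt_inner h h
  have one : ∀ (A : Π y : M, TangentSpace I y) {y}, SmoothNear Z y →
      mvfderiv I (fun y ↦ inner ℝ (Z y) (Z y)) y (A y) = 2 * inner ℝ (nabla A Z y) (Z y) := by
    intro A y h
    rw [mvfderiv_inner_eq A h.mdiff h.mdiff, real_inner_comm (nabla A Z y)]
    ring
  have two : ∀ {A B : Π y : M, TangentSpace I y}, SmoothNear A x → SmoothNear B x →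
      mvfderiv I (fun y ↦ mvfderiv I (fun y ↦ inner ℝ (Z y) (Z y)) y (B y)) x (A x)
        = 2 * (inner ℝ (nabla A (nabla B Z) x) (Z x)
          + inner ℝ (nabla B Z x) (nabla A Z x)) := by
    intro A B hA hB
    have h1 : (fun y ↦ mvfderiv I (fun y ↦ inner ℝ (Z y) (Z y)) y (B y)) =ᶠ[𝓝 x]
        fun y ↦ 2 * inner ℝ (nabla B Z y) (Z y) := by
      filter_upwards [hZ.eventually] with y hy using one B hy
    have h2 := contMDiffAt_inner (hB.nabla hZ).contMDiffAt hZ.contMDiffAt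
    rw [mvfderiv_congr h1, mvfderiv_fun_mul mdifferentiableAt_const
      (h2.mdifferentiableAt (by simp))]
    simp [mvfderiv_const, mvfderiv_inner_eq A (hB.nabla hZ).mdiff hZ.mdiff]
  have h := mvfderiv_mvfderiv_sub hf hX hY
  rw [two hX hY, two hY hX, one _ hZ, real_inner_comm (nabla X Z x) (nabla Y Z x)] at h
  rw [curvature_eq, inner_sub_left, inner_sub_left]
  linarith

theorem inner_riemann_self (x : M) (u v w : TangentSpace I x) :
    inner ℝ (riemann x u v w) w = 0 := by
  simpa using! inner_curvature_self (smoothNear_extend u) (smoothNear_extend v)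
    (smoothNear_extend w)

theorem inner_riemann_swap (x : M) (u v w z : TangentSpace I x) :
    inner ℝ (riemann x u v w) z = -inner ℝ (riemann x u v z) w := by
  have h := inner_riemann_self x u v (w + z)
  rw [riemann_add_right, inner_add_left, inner_add_right, inner_add_right, inner_riemann_self,
    inner_riemann_self] at h
  linarith

theorem riemann_bianchi (x : M) (u v w : TangentSpace I x) :
    riemann x u v w + riemann x v w u + riemann x w u v = 0 :=
  curvature_bianchi (smoothNear_extend u) (smoothNear_extend v) (smoothNear_extend w)

/-- A vector annihilated by all curvature operators annihilates the curvature in its other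
arguments, too. -/
theorem riemann_eq_zero_of_forall {v : TangentSpace I x}
    (h : ∀ u w : TangentSpace I x, riemann x u w v = 0) (u w : TangentSpace I x) :
    riemann x v u w = 0 := by
  -- By Bianchi, `⟨Rm(v, a)b, c⟩` is symmetric in `a, b`; it is also skew in `b, c`. A trilinear
  -- form with both properties is zero, as three alternating exchanges show.
  have symm : ∀ a b : TangentSpace I x, riemann x v a b = riemann x v b a := by
    intro a b
    have := riemann_bianchi x v a b
    rw [h, add_zero, riemann_swap x b v, ← sub_eq_add_neg, sub_eq_zero] at this
    exact this
  refine ext_inner_right ℝ fun z ↦ ?_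
  rw [inner_zero_left]
  have h1 := inner_riemann_swap x v u w z
  have h2 := inner_riemann_swap x v z u w
  have h3 := inner_riemann_swap x v w z u
  rw [symm u z] at h1
  rw [symm z w] at h2
  rw [symm w u] at h3
  linarith

end Curvature

/-! ### Traces over orthonormal bases -/

section Trace

variable {V : Type*} [NormedAddCommGroup V] [InnerProductSpace ℝ V] {ι κ : Type*} [Fintype ι]
  [Fintype κ]

/-- The trace of a bilinear form with respect to the inner product does not depend on the
orthonormal basis. -/
theorem sum_bilin_orthonormalBasis (B : V →ₗ[ℝ] V →ₗ[ℝ] ℝ) (b : OrthonormalBasis ι ℝ V)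
    (c : OrthonormalBasis κ ℝ V) : ∑ i, B (b i) (b i) = ∑ k, B (c k) (c k) := by
  classical
  have h1 : ∀ i, B (b i) (b i)
      = ∑ k, ∑ l, inner ℝ (c k) (b i) * inner ℝ (b i) (c l) * B (c k) (c l) := by
    intro i
    conv_lhs => rw [← c.sum_repr' (b i)]
    simp only [map_sum, map_smul, LinearMap.sum_apply, LinearMap.smul_apply, smul_eq_mul,
      Finset.mul_sum]
    rw [Finset.sum_comm]
    refine Finset.sum_congr rfl fun k _ ↦ Finset.sum_congr rfl fun l _ ↦ ?_
    rw [real_inner_comm (b i) (c l)]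
    ring
  simp_rw [h1]
  rw [Finset.sum_comm]
  refine Finset.sum_congr rfl fun k _ ↦ ?_
  rw [Finset.sum_comm]
  simp_rw [← Finset.sum_mul, b.sum_inner_mul_inner, c.inner_eq_ite]
  simp

/-- Infinitesimal form of basis independence: `a` is the velocity of a rotating orthonormal basis,
so its matrix is skew and the trace of `B` does not change to first order. -/
theorem sum_bilin_skew (B : V →ₗ[ℝ] V →ₗ[ℝ] ℝ) (b : OrthonormalBasis ι ℝ V) (a : ι → V)
    (ha : ∀ i j, inner ℝ (a i) (b j) + inner ℝ (b i) (a j) = 0) :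
    ∑ i, (B (a i) (b i) + B (b i) (a i)) = 0 := by
  have h1 : ∀ i, B (a i) (b i) = ∑ k, inner ℝ (b k) (a i) * B (b k) (b i) := by
    intro i
    conv_lhs => rw [← b.sum_repr' (a i)]
    simp
  have h2 : ∀ i, B (b i) (a i) = ∑ k, inner ℝ (b k) (a i) * B (b i) (b k) := by
    intro i
    conv_lhs => rw [← b.sum_repr' (a i)]
    simp
  rw [Finset.sum_add_distrib, Finset.sum_congr rfl fun i _ ↦ h1 i,
    Finset.sum_congr rfl fun i _ ↦ h2 i]
  conv_lhs => enter [2]; rw [Finset.sum_comm]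
  rw [← Finset.sum_add_distrib]
  refine Finset.sum_eq_zero fun i _ ↦ ?_
  rw [← Finset.sum_add_distrib]
  refine Finset.sum_eq_zero fun k _ ↦ ?_
  rw [← add_mul, real_inner_comm (a i) (b k), ha, zero_mul]

end Trace

/-! ### Concurrent fields and the scaling of curvature -/

section Concurrent

set_option linter.unusedSectionVars false

variable {E : Type*} [NormedAddCommGroup E] [NormedSpace ℝ E] [FiniteDimensional ℝ E]
  {H : Type*} [TopologicalSpace H] {I : ModelWithCorners ℝ E H}
  {M : Type*} [TopologicalSpace M] [ChartedSpace H M] [IsManifold I ∞ M]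
  [RiemannianBundle (fun x : M ↦ TangentSpace I x)]
  [IsContMDiffRiemannianBundle I ∞ E (fun x : M ↦ TangentSpace I x)]
  {v X Y Z : Π x : M, TangentSpace I x} {x : M}

/-- The form `(a, b) ↦ ⟨Rm(a, u)w, b⟩`. -/
def riemannOuter (x : M) (u w : TangentSpace I x) :
    TangentSpace I x →ₗ[ℝ] TangentSpace I x →ₗ[ℝ] ℝ :=
  LinearMap.mk₂ ℝ (fun a b ↦ inner ℝ (riemann x a u w) b)
    (fun a a' b ↦ by rw [riemann_add_left, inner_add_left])
    (fun c a b ↦ by rw [riemann_smul_left, real_inner_smul_left, smul_eq_mul])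
    (fun a b b' ↦ inner_add_right _ _ _)
    (fun c a b ↦ real_inner_smul_right _ _ _)

/-- The form `(u, w) ↦ ⟨Rm(a, u)w, b⟩`. -/
def riemannInner (x : M) (a b : TangentSpace I x) :
    TangentSpace I x →ₗ[ℝ] TangentSpace I x →ₗ[ℝ] ℝ :=
  LinearMap.mk₂ ℝ (fun u w ↦ inner ℝ (riemann x a u w) b)
    (fun u u' w ↦ by rw [riemann_add_middle, inner_add_left])
    (fun c u w ↦ by rw [riemann_smul_middle, real_inner_smul_left, smul_eq_mul])
    (fun u w w' ↦ by rw [riemann_add_right, inner_add_left])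
    (fun c u w ↦ by rw [riemann_smul_right, real_inner_smul_left, smul_eq_mul])

/-- The scalar curvature in terms of an arbitrary orthonormal basis. -/
theorem scalarCurvature_eq {e : Fin (finrank ℝ E) → TangentSpace I x} (he : Orthonormal ℝ e) :
    scalarCurvature I x = ∑ i, ∑ j, inner ℝ (riemann x (e j) (e i) (e i)) (e j) := by
  have := finDim_tangentSpace (I := I) x
  set b := orthonormalBasisOfOrthonormal he with hb
  have hbe : ∀ i, b i = e i := fun i ↦ by simp [hb, orthonormalBasisOfOrthonormal]
  set s := stdOrthonormalBasis ℝ (TangentSpace I x)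
  have h1 : ∀ j, ∑ i, inner ℝ (riemann x (s j) (s i) (s i)) (s j)
      = ∑ i, inner ℝ (riemann x (s j) (b i) (b i)) (s j) :=
    fun j ↦ sum_bilin_orthonormalBasis (riemannInner x (s j) (s j)) s b
  have h2 : ∀ i, ∑ j, inner ℝ (riemann x (s j) (b i) (b i)) (s j)
      = ∑ j, inner ℝ (riemann x (b j) (b i) (b i)) (b j) :=
    fun i ↦ sum_bilin_orthonormalBasis (riemannOuter x (b i) (b i)) s b
  calc scalarCurvature I x = ∑ i, ∑ j, inner ℝ (riemann x (s j) (s i) (s i)) (s j) := rfl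
    _ = ∑ i, ∑ j, inner ℝ (riemann x (b j) (b i) (b i)) (b j) := by
      rw [Finset.sum_comm, Finset.sum_congr rfl fun j _ ↦ h1 j, Finset.sum_comm,
        Finset.sum_congr rfl fun i _ ↦ h2 i]
    _ = _ := by simp only [hbe]

theorem mvfderiv_sum {ι : Type*} (s : Finset ι) {f : ι → M → ℝ}
    (hf : ∀ i ∈ s, CMDiffAt ∞ (f i) x) (u : TangentSpace I x) :
    mvfderiv I (fun y ↦ ∑ i ∈ s, f i y) x u = ∑ i ∈ s, mvfderiv I (f i) x u := by
  classical
  induction s using Finset.induction_on with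
  | empty => simp [mvfderiv_const]
  | insert i s hi ih =>
    have h : ∀ j ∈ s, CMDiffAt ∞ (f j) x := fun j hj ↦ hf j (Finset.mem_insert_of_mem hj)
    simp only [Finset.sum_insert hi]
    rw [mvfderiv_fun_add ((hf i (Finset.mem_insert_self i s)).mdifferentiableAt (by simp))
      ((contMDiffAt_finsetSum h).mdifferentiableAt (by simp)), ← ih h]
    rfl

theorem IsConcurrent.smoothNear (hv : IsConcurrent v) (x : M) : SmoothNear v x :=
  Eventually.of_forall hv.smooth

theorem IsConcurrent.nabla_right (hv : IsConcurrent v) (X : Π x : M, TangentSpace I x) :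
    nabla X v = X :=
  funext fun y ↦ hv.eq y (X y)

theorem IsConcurrent.nabla_left (hv : IsConcurrent v) (hX : MDiffAt (T% X) x) :
    nabla v X x = mlieBracket I v X x + X x := by
  rw [← nabla_sub_nabla (hv.smoothNear x).mdiff hX, hv.nabla_right, sub_add_cancel]

/-- Since `∇_A v = A` for every `A`, the curvature applied to `v` is `∇_u w - ∇_w u - [u, w]`, the
torsion. -/
theorem IsConcurrent.riemann_right (hv : IsConcurrent v) (x : M) (u w : TangentSpace I x) :
    riemann x u w (v x) = 0 := by
  have hu := smoothNear_extend u
  have hw := smoothNear_extend w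
  have h := curvature_eq_riemann hu hw (hv.smoothNear x)
  rw [curvature_eq, hv.nabla_right, hv.nabla_right, hv.nabla_right,
    nabla_sub_nabla hu.mdiff hw.mdiff, sub_self] at h
  simpa using! h.symm

/-- A concurrent vector field is an infinitesimal affine transformation:
`[v, ∇_X Y] = ∇_[v, X] Y + ∇_X [v, Y]`. -/
theorem IsConcurrent.nabla_nabla (hv : IsConcurrent v) (hX : SmoothNear X x)
    (hY : SmoothNear Y x) :
    nabla v (nabla X Y) x = nabla X (nabla v Y) x + nabla (nabla v X) Y x - nabla X Y x := by
  -- `Rm(v, X)Y = 0` gives `∇_v ∇_X Y = ∇_X ∇_v Y + ∇_[v, X] Y`, and `[v, X] = ∇_v X - X`.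
  have h := curvature_eq_riemann (hv.smoothNear x) hX hY
  rw [riemann_eq_zero_of_forall (hv.riemann_right x), curvature_eq] at h
  have h2 : nabla (nabla v X) Y x = nabla (mlieBracket I v X + X) Y x :=
    nabla_congr (hv.nabla_left hX.mdiff) hY (EventuallyEq.refl _ _)
  rw [h2, nabla_add_left, Pi.add_apply, add_sub_assoc, add_sub_assoc, sub_self, add_zero,
    ← sub_eq_zero, ← h]
  abel

/-- This is Jacobi with `[v, ·] = ∇_v - id`: the identity enters once on the left and twice on the
right, whence the correction `-[X, Y]`. -/
theorem IsConcurrent.nabla_mlieBracket (hv : IsConcurrent v) (hX : SmoothNear X x)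
    (hY : SmoothNear Y x) :
    nabla v (mlieBracket I X Y) x
      = mlieBracket I (nabla v X) Y x + mlieBracket I X (nabla v Y) x - mlieBracket I X Y x := by
  have hvx := hv.smoothNear x
  have h1 : ∀ {A : Π x : M, TangentSpace I x}, SmoothNear A x →
      nabla v A =ᶠ[𝓝 x] mlieBracket I v A + A := by
    intro A hA
    filter_upwards [hA.eventually] with y hy using hv.nabla_left hy.mdiff
  rw [hv.nabla_left (hX.mlieBracket hY).mdiff, mlieBracket_jacobi hvx hX hY,
    EventuallyEq.mlieBracket_vectorField_eq (h1 hX) (EventuallyEq.refl _ Y),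
    EventuallyEq.mlieBracket_vectorField_eq (EventuallyEq.refl _ X) (h1 hY),
    mlieBracket_add_left (hvx.mlieBracket hX).mdiff hX.mdiff,
    mlieBracket_add_right (hvx.mlieBracket hY).mdiff hY.mdiff]
  abel

/-- For a concurrent vector field, `∇_v Rm = -2 Rm`. -/
theorem IsConcurrent.nabla_curvature (hv : IsConcurrent v) (hX : SmoothNear X x)
    (hY : SmoothNear Y x) (hZ : SmoothNear Z x) :
    nabla v (curvature X Y Z) x
      = curvature (nabla v X) Y Z x + curvature X (nabla v Y) Z x + curvature X Y (nabla v Z) x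
        - (2 : ℝ) • curvature X Y Z x := by
  have hvx := hv.smoothNear x
  -- Moving `∇_v` past each of the two covariant derivatives costs one copy of the term, hence the
  -- factor 2. The bracket term also loses two copies: one through `nabla_nabla`, one through `h3`.
  have two : ∀ {A B : Π x : M, TangentSpace I x}, SmoothNear A x → SmoothNear B x →
      nabla v (nabla A (nabla B Z)) x = nabla A (nabla B (nabla v Z)) x
        + nabla A (nabla (nabla v B) Z) x + nabla (nabla v A) (nabla B Z) x
        - (2 : ℝ) • nabla A (nabla B Z) x := by
    intro A B hA hB
    have h1 : nabla v (nabla B Z) =ᶠ[𝓝 x]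
        nabla B (nabla v Z) + nabla (nabla v B) Z - nabla B Z := by
      filter_upwards [hB.eventually, hZ.eventually] with y h1 h2 using hv.nabla_nabla h1 h2
    have s1 := hB.nabla (hvx.nabla hZ)
    have s2 := (hvx.nabla hB).nabla hZ
    have s3 := hB.nabla hZ
    rw [hv.nabla_nabla hA s3, nabla_congr (X := A) rfl (hvx.nabla s3) h1,
      nabla_sub_right A (s1.add s2).mdiff s3.mdiff, nabla_add_right A s1.mdiff s2.mdiff]
    module
  have hbr := hX.mlieBracket hY
  have h3 : nabla (nabla v (mlieBracket I X Y)) Z x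
      = nabla (mlieBracket I (nabla v X) Y) Z x + nabla (mlieBracket I X (nabla v Y)) Z x
        - nabla (mlieBracket I X Y) Z x := by
    unfold nabla
    rw [← map_add, ← map_sub]
    exact congrArg _ (hv.nabla_mlieBracket hX hY)
  have h4 : curvature X Y Z = nabla X (nabla Y Z) - nabla Y (nabla X Z)
      - nabla (mlieBracket I X Y) Z := rfl
  have t1 := hX.nabla (hY.nabla hZ)
  have t2 := hY.nabla (hX.nabla hZ)
  rw [h4, nabla_sub_right v (t1.sub t2).mdiff (hbr.nabla hZ).mdiff,
    nabla_sub_right v t1.mdiff t2.mdiff, two hX hY, two hY hX, hv.nabla_nabla hbr hZ, h3]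
  simp only [curvature_eq, Pi.sub_apply]
  module

/-- For a concurrent vector field, `v(R) = -2 R`. -/
theorem IsConcurrent.mvfderiv_scalarCurvature (hv : IsConcurrent v) (x : M) :
    mvfderiv I (scalarCurvature I) x (v x) = -2 * scalarCurvature I x := by
  obtain ⟨e, hs, he⟩ := exists_orthonormalFrame I x
  have hvx := hv.smoothNear x
  have hR : scalarCurvature I =ᶠ[𝓝 x]
      fun y ↦ ∑ i, ∑ j, inner ℝ (curvature (e j) (e i) (e i) y) (e j y) := by
    have hs' : ∀ᶠ y in 𝓝 x, ∀ i, SmoothNear (e i) y :=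
      eventually_all.2 fun i ↦ (hs i).eventually
    filter_upwards [he, hs'] with y h1 h2
    rw [scalarCurvature_eq h1]
    simp only [curvature_eq_riemann (h2 _) (h2 _) (h2 _)]
  have hsm : ∀ i j, CMDiffAt ∞ (fun y ↦ inner ℝ (curvature (e j) (e i) (e i) y) (e j y)) x :=
    fun i j ↦ contMDiffAt_inner ((hs j).curvature (hs i) (hs i)).contMDiffAt (hs j).contMDiffAt
  -- The frame need not be parallel along `v`; `a` records its derivative at `x`. In `hterm` the
  -- contributions of `a` are paired so that one pair sums to zero over `j` and the other over `i`.
  set a : Fin (finrank ℝ E) → TangentSpace I x := fun i ↦ nabla v (e i) x with ha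
  have hterm : ∀ i j, mvfderiv I (fun y ↦ inner ℝ (curvature (e j) (e i) (e i) y) (e j y)) x (v x)
      = (riemannOuter x (e i x) (e i x) (a j) (e j x)
          + riemannOuter x (e i x) (e i x) (e j x) (a j))
        + (riemannInner x (e j x) (e j x) (a i) (e i x)
          + riemannInner x (e j x) (e j x) (e i x) (a i))
        - 2 * inner ℝ (riemann x (e j x) (e i x) (e i x)) (e j x) := by
    intro i j
    have hi := hvx.nabla (hs i)
    have hj := hvx.nabla (hs j)
    rw [mvfderiv_inner_eq v ((hs j).curvature (hs i) (hs i)).mdiff (hs j).mdiff,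
      hv.nabla_curvature (hs j) (hs i) (hs i), curvature_eq_riemann hj (hs i) (hs i),
      curvature_eq_riemann (hs j) hi (hs i), curvature_eq_riemann (hs j) (hs i) hi,
      curvature_eq_riemann (hs j) (hs i) (hs i)]
    simp only [inner_add_left, inner_sub_left, real_inner_smul_left, riemannOuter, riemannInner,
      LinearMap.mk₂_apply, ha]
    ring
  set b := orthonormalBasisOfOrthonormal he.self_of_nhds with hb
  have hbe : ∀ i, b i = e i x := fun i ↦ by simp [hb, orthonormalBasisOfOrthonormal]
  have hskew : ∀ i j, inner ℝ (a i) (b j) + inner ℝ (b i) (a j) = 0 := by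
    intro i j
    rw [hbe, hbe, ← mvfderiv_inner_eq v (hs i).mdiff (hs j).mdiff]
    -- Skewness comes from differentiating `⟨e i, e j⟩ = δ_ij`.
    have hc : (fun y ↦ inner ℝ (e i y) (e j y)) =ᶠ[𝓝 x] fun _ ↦ if i = j then (1 : ℝ) else 0 := by
      filter_upwards [he] with y hy using orthonormal_iff_ite.1 hy i j
    rw [mvfderiv_congr hc, mvfderiv_const]
    rfl
  have houter : ∀ i, ∑ j, (riemannOuter x (e i x) (e i x) (a j) (e j x)
      + riemannOuter x (e i x) (e i x) (e j x) (a j)) = 0 := by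
    intro i
    have := sum_bilin_skew (riemannOuter x (e i x) (e i x)) b a hskew
    simpa only [hbe] using this
  have hinner : ∀ j, ∑ i, (riemannInner x (e j x) (e j x) (a i) (e i x)
      + riemannInner x (e j x) (e j x) (e i x) (a i)) = 0 := by
    intro j
    have := sum_bilin_skew (riemannInner x (e j x) (e j x)) b a hskew
    simpa only [hbe] using this
  rw [mvfderiv_congr hR, mvfderiv_sum _ fun i _ ↦ contMDiffAt_finsetSum fun j _ ↦ hsm i j,
    Finset.sum_congr rfl fun i _ ↦ mvfderiv_sum _ (fun j _ ↦ hsm i j) (v x)]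
  simp only [hterm, Finset.sum_sub_distrib, Finset.sum_add_distrib (f := fun j ↦
    riemannOuter x _ _ (a j) (e j x) + riemannOuter x _ _ (e j x) (a j)), houter]
  rw [Finset.sum_add_distrib, Finset.sum_comm, Finset.sum_congr rfl fun j _ ↦ hinner j,
    scalarCurvature_eq he.self_of_nhds]
  simp [Finset.mul_sum]

theorem IsConcurrent.lieDerivMetric_eq (hv : IsConcurrent v) (hX : MDiffAt (T% X) x)
    (hY : MDiffAt (T% Y) x) : lieDerivMetric v X Y x = 2 * inner ℝ (X x) (Y x) := by
  have hvx := (hv.smoothNear x).mdiff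
  rw [lieDerivMetric, mvfderiv_inner_eq v hX hY, ← nabla_sub_nabla hvx hX,
    ← nabla_sub_nabla hvx hY, hv.nabla_right, hv.nabla_right, inner_sub_left, inner_sub_right]
  ring

/-- A concurrent vector field is the gradient of half its squared norm. -/
theorem IsConcurrent.isGradient (hv : IsConcurrent v) :
    IsGradient v (fun y ↦ 1 / 2 * inner ℝ (v y) (v y)) := by
  intro x u
  have hvx := hv.smoothNear x
  have hi := (contMDiffAt_inner hvx.contMDiffAt hvx.contMDiffAt).mdifferentiableAt (by simp)
  have h := mvfderiv_inner_eq (FiberBundle.extend E u) hvx.mdiff hvx.mdiff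
  rw [hv.nabla_right, FiberBundle.extend_apply_self, real_inner_comm (v x) u] at h
  rw [mvfderiv_fun_mul mdifferentiableAt_const hi]
  simp [mvfderiv_const, h, -inner_self_eq_norm_sq_to_K]
  ring

/-- With `L_v g = 2g` the soliton equation is `(R - ρ)g = g`; a nonzero tangent vector, available in
positive dimension, allows `g` to be cancelled. -/
theorem IsConcurrent.scalarCurvature_eq_add_one [Nontrivial E] (hv : IsConcurrent v) {ρ : ℝ}
    (hsol : IsYamabeSoliton v ρ) (x : M) : scalarCurvature I x = ρ + 1 := by
  have : Nontrivial (TangentSpace I x) := ‹Nontrivial E›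
  obtain ⟨u, hu⟩ := exists_ne (0 : TangentSpace I x)
  have hs := smoothNear_extend u
  have h := hsol.eq x _ _ hs.contMDiffAt hs.contMDiffAt
  rw [hv.lieDerivMetric_eq hs.mdiff hs.mdiff, FiberBundle.extend_apply_self] at h
  have h0 : inner ℝ u u ≠ 0 := inner_self_ne_zero.2 hu
  have : scalarCurvature I x - ρ = 1 := mul_right_cancel₀ h0 (by linarith)
  linarith

theorem IsConcurrent.scalarCurvature_eq_zero [Nontrivial E] (hv : IsConcurrent v) {ρ : ℝ}
    (hsol : IsYamabeSoliton v ρ) (x : M) : scalarCurvature I x = 0 := by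
  have h := hv.mvfderiv_scalarCurvature x
  have hc : scalarCurvature I = fun _ : M ↦ ρ + 1 :=
    funext (hv.scalarCurvature_eq_add_one hsol)
  rw [mvfderiv_congr (EventuallyEq.of_eq hc), mvfderiv_const] at h
  simpa using h

end Concurrent

end YamabeSoliton

end

/-! ### The main theorem -/

theorem corollary3p4 {n : ℕ} (hn : 1 ≤ n)
    {M : Type*} [TopologicalSpace M] [ChartedSpace (EuclideanSpace ℝ (Fin n)) M]
    [IsManifold (𝓡 n) ∞ M] [Nonempty M]
    [RiemannianBundle (fun x : M ↦ TangentSpace (𝓡 n) x)]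
    [IsContMDiffRiemannianBundle (𝓡 n) ∞ (EuclideanSpace ℝ (Fin n))
      (fun x : M ↦ TangentSpace (𝓡 n) x)]
    (v : Π x : M, TangentSpace (𝓡 n) x) (ρ : ℝ)
    (hsol : YamabeSoliton.IsYamabeSoliton v ρ)
    (hconc : YamabeSoliton.IsConcurrent v) :
    YamabeSoliton.IsGradientYamabeSoliton v ρ ∧
      YamabeSoliton.IsExpandingYamabeSoliton v ρ ∧
      (∀ x : M, YamabeSoliton.scalarCurvature (𝓡 n) x = 0) ∧
      ρ = -1 := by
  have : Nontrivial (EuclideanSpace ℝ (Fin n)) :=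
    Module.nontrivial_of_finrank_pos (R := ℝ) (by rw [finrank_euclideanSpace_fin]; exact hn)
  obtain ⟨x⟩ := ‹Nonempty M›
  have h1 := hconc.scalarCurvature_eq_add_one hsol x
  have h2 := hconc.scalarCurvature_eq_zero hsol
  have hρ : ρ = -1 := by linarith [h2 x]
  -- The potential `_` is determined by `hconc.isGradient`: it is `1/2 * ⟨v, v⟩`.
  refine ⟨⟨hsol, _, fun y ↦ ?_, hconc.isGradient⟩, ⟨hsol, by linarith⟩, h2, hρ⟩
  exact contMDiffAt_const.mul (YamabeSoliton.contMDiffAt_inner (hconc.smooth y) (hconc.smooth y))
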